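/- Let $\mathrm{CZF}^-$ be the theory in intuitionistic first-order logic with equality, with $\in$ as its only non-logical symbol, whose axioms are Extensionality, Pair, Union, Infinity, Separation for restricted formulas, Strong Collection and Set Induction (that is, Aczel's constructive set theory CZF without Subset Collection). Let $\mathrm{Sep}$ be the Separation scheme for all formulas. As usual, classes and class relations are given by formulas, possibly with parameters. A (large) $\bigvee$-semilattice is a class $L$ with a class relation $\le$ that partially orders it, such that every subset of $L$ has a supremum. It is set-generated, with generating set $B$, if $B$ is a subset of $L$ such that for all $x\in L$ the class $\downarrow x=\{b\in B\mid b\le x\}$ is a set and $x=\bigvee \downarrow x$. For a class $\Phi\subseteq B\times L$ of pairs, a class $Y\subseteq B$ is called $\Phi$-closed if $\downarrow\bigvee U\subseteq Y$ for every subset $U$ of $Y$, and, for all $(b,a)\in\Phi$, $\downarrow a\subseteq Y$ implies $b\in Y$. Let $\mathcal I(\Phi)$ denote the least $\Phi$-closed class, if it exists. For a monotone class function $\Gamma:L\to L$ let $\Phi_\Gamma=\{(b,a)\in B\times L\mid b\le\Gamma(a)\}$. **Corollary (Tarski's fixed point theorem in $\mathrm{CZF}^-+\mathrm{Sep}$).**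 $\mathrm{CZF}^-+\mathrm{Sep}$ proves that every monotone operator on a set-generated $\bigvee$-semilattice has a least fixed point. More precisely, for all formulas defining $L$, $\le$ and $\Gamma$ (with parameters) and every set variable $B$, there is a formula defining a class $\mathcal I(\Phi_\Gamma)$ such that $\mathrm{CZF}^-+\mathrm{Sep}$ proves the following, under the assumption that $(L,\le)$ is a $\bigvee$-semilattice with generating set $B$ and $\Gamma:L\to L$ is monotone: $\mathcal I(\Phi_\Gamma)$ is $\Phi_\Gamma$-closed; it is contained in $Y$ whenever $Y$ is a $\Phi_\Gamma$-closed class (one such theorem for each formula defining a class $Y$); it is a set; and $\bigvee\mathcal I(\Phi_\Gamma)$ is the least fixed point of $\Gamma$. -/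

import Mathlib

namespace CST

/-! ### First-order formulas of set theory

The only non-logical symbol is membership, so the only terms are variables. Variables are
de Bruijn indices: below `n` quantifiers, indices `< n` are bound and `n + k` is the free
variable number `k`. Since the logic is intuitionistic, all connectives and both quantifiers
are primitive. -/

inductive Fml : Type
  | bot : Fml
  | eq (i j : ℕ) : Fml
  | mem (i j : ℕ) : Fml
  | and (φ ψ : Fml) : Fml
  | or (φ ψ : Fml) : Fml
  | imp (φ ψ : Fml) : Fml
  | all (φ : Fml) : Fml
  | ex (φ : Fml) : Fml

namespace Fml

/-- The renaming `ρ`, carried under one quantifier. -/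
def lift (ρ : ℕ → ℕ) : ℕ → ℕ
  | 0 => 0
  | n + 1 => ρ n + 1

/-- Simultaneous capture-avoiding substitution of variables for the free variables. -/
def rename : (ℕ → ℕ) → Fml → Fml
  | _, bot => bot
  | ρ, eq i j => eq (ρ i) (ρ j)
  | ρ, mem i j => mem (ρ i) (ρ j)
  | ρ, and φ ψ => and (rename ρ φ) (rename ρ ψ)
  | ρ, or φ ψ => or (rename ρ φ) (rename ρ ψ)
  | ρ, imp φ ψ => imp (rename ρ φ) (rename ρ ψ)
  | ρ, all φ => all (rename (lift ρ) φ)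
  | ρ, ex φ => ex (rename (lift ρ) φ)

/-- Weakening: the free variable `k` becomes `k + 1`, so that `0` is fresh. -/
def shift (φ : Fml) : Fml := φ.rename Nat.succ

/-- `φ[t/x]`, where `x` is the variable `0` of `φ`, that is, the one bound in `all φ`. -/
def inst (φ : Fml) (t : ℕ) : Fml :=
  φ.rename fun
    | 0 => t
    | n + 1 => n

/-- Restricted formulas: every quantifier is of the form `∀ x ∈ y` or `∃ x ∈ y`. -/
inductive IsRestricted : Fml → Prop
  | bot : IsRestricted bot
  | eq (i j : ℕ) : IsRestricted (eq i j)
  | mem (i j : ℕ) : IsRestricted (mem i j)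
  | and {φ ψ : Fml} : IsRestricted φ → IsRestricted ψ → IsRestricted (and φ ψ)
  | or {φ ψ : Fml} : IsRestricted φ → IsRestricted ψ → IsRestricted (or φ ψ)
  | imp {φ ψ : Fml} : IsRestricted φ → IsRestricted ψ → IsRestricted (imp φ ψ)
  | all {φ : Fml} (j : ℕ) : IsRestricted φ → IsRestricted (all (imp (mem 0 (j + 1)) φ))
  | ex {φ : Fml} (j : ℕ) : IsRestricted φ → IsRestricted (ex (and (mem 0 (j + 1)) φ))

end Fml

/-! ### Intuitionistic first-order logic with equality -/

/-- Natural deduction: `Prf T Γ φ` says that `φ` is derivable from the non-logical axioms `T` and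
the open assumptions `Γ`. Free variables of a member of `T` are implicitly universally
quantified, those of a member of `Γ` are not. -/
inductive Prf (T : Set Fml) : List Fml → Fml → Prop
  | ax {Γ : List Fml} {φ : Fml} : φ ∈ T → Prf T Γ φ
  | hyp {Γ : List Fml} {φ : Fml} : φ ∈ Γ → Prf T Γ φ
  | botE {Γ : List Fml} {φ : Fml} : Prf T Γ .bot → Prf T Γ φ
  | andI {Γ : List Fml} {φ ψ : Fml} : Prf T Γ φ → Prf T Γ ψ → Prf T Γ (.and φ ψ)
  | andE₁ {Γ : List Fml} {φ ψ : Fml} : Prf T Γ (.and φ ψ) → Prf T Γ φ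
  | andE₂ {Γ : List Fml} {φ ψ : Fml} : Prf T Γ (.and φ ψ) → Prf T Γ ψ
  | orI₁ {Γ : List Fml} {φ ψ : Fml} : Prf T Γ φ → Prf T Γ (.or φ ψ)
  | orI₂ {Γ : List Fml} {φ ψ : Fml} : Prf T Γ ψ → Prf T Γ (.or φ ψ)
  | orE {Γ : List Fml} {φ ψ χ : Fml} :
      Prf T Γ (.or φ ψ) → Prf T (φ :: Γ) χ → Prf T (ψ :: Γ) χ → Prf T Γ χ
  | impI {Γ : List Fml} {φ ψ : Fml} : Prf T (φ :: Γ) ψ → Prf T Γ (.imp φ ψ)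
  | impE {Γ : List Fml} {φ ψ : Fml} : Prf T Γ (.imp φ ψ) → Prf T Γ φ → Prf T Γ ψ
  | allI {Γ : List Fml} {φ : Fml} : Prf T (Γ.map Fml.shift) φ → Prf T Γ (.all φ)
  | allE {Γ : List Fml} {φ : Fml} (t : ℕ) : Prf T Γ (.all φ) → Prf T Γ (φ.inst t)
  | exI {Γ : List Fml} {φ : Fml} (t : ℕ) : Prf T Γ (φ.inst t) → Prf T Γ (.ex φ)
  | exE {Γ : List Fml} {φ ψ : Fml} :
      Prf T Γ (.ex φ) → Prf T (φ :: Γ.map Fml.shift) ψ.shift → Prf T Γ ψ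
  | eqRefl {Γ : List Fml} (t : ℕ) : Prf T Γ (.eq t t)
  | eqSubst {Γ : List Fml} {φ : Fml} {s t : ℕ} :
      Prf T Γ (.eq s t) → Prf T Γ (φ.inst s) → Prf T Γ (φ.inst t)

/-! ### Writing formulas with named bound variables

A `Sc` (scoped formula) is a formula as seen below `d` quantifiers, for each `d`; a `Var` is a
variable as seen below `d` quantifiers. `All fun x => …` and `Ex fun x => …` are the two
quantifiers, and the formula meant by `p : Sc` is `p 0`. -/

abbrev Var : Type := ℕ → ℕ
abbrev Sc : Type := ℕ → Fml

/-- The free variable number `k`. -/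
def free (k : ℕ) : Var := fun d => k + d

def All (p : Var → Sc) : Sc := fun d => .all (p (fun e => e - (d + 1)) (d + 1))
def Ex (p : Var → Sc) : Sc := fun d => .ex (p (fun e => e - (d + 1)) (d + 1))
def Mem (x y : Var) : Sc := fun d => .mem (x d) (y d)
def Eqv (x y : Var) : Sc := fun d => .eq (x d) (y d)
def Conj (p q : Sc) : Sc := fun d => .and (p d) (q d)
def Disj (p q : Sc) : Sc := fun d => .or (p d) (q d)
def Impl (p q : Sc) : Sc := fun d => .imp (p d) (q d)

infix:50 " ∊ " => Mem
infix:50 " ≐ " => Eqv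
infixr:35 " ⩓ " => Conj
infixr:30 " ⩔ " => Disj
infixr:25 " ⟾ " => Impl

def Equi (p q : Sc) : Sc := (p ⟾ q) ⩓ (q ⟾ p)

infix:20 " ⟺ " => Equi

/-- The class `{x | φ(x)}` with parameters: the variable `0` of `φ` is `x`, and the variable
`k + 1` of `φ` is the free variable number `k`. -/
def cls (φ : Fml) (x : Var) : Sc := fun d =>
  φ.rename fun
    | 0 => x d
    | k + 1 => k + d

/-- The class relation `{(x, y) | φ(x, y)}` with parameters: the variables `0` and `1` of `φ` are
`x` and `y`, and the variable `k + 2` of `φ` is the free variable number `k`. -/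
def rel (φ : Fml) (x y : Var) : Sc := fun d =>
  φ.rename fun
    | 0 => x d
    | 1 => y d
    | k + 2 => k + d

/-- The theory `T` proves (the universal closure of) `p`. -/
def Proves (T : Set Fml) (p : Sc) : Prop := Prf T [] (p 0)

/-! ### The axioms -/

def extensionality : Sc :=
  All fun a => All fun b => (All fun y => y ∊ a ⟺ y ∊ b) ⟾ a ≐ b

def pairing : Sc :=
  All fun a => All fun b => Ex fun x => All fun y => y ∊ x ⟺ (y ≐ a ⩔ y ≐ b)

def union : Sc :=
  All fun a => Ex fun x => All fun y => y ∊ x ⟺ Ex fun z => z ∊ a ⩓ y ∊ z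

def infinity : Sc :=
  Ex fun a => (Ex fun x => x ∊ a) ⩓ All fun x => x ∊ a ⟾ Ex fun y => y ∊ a ⩓ x ∊ y

/-- The instance of Separation for the class `φ`. -/
def separation (φ : Fml) : Sc :=
  All fun a => Ex fun x => All fun y => y ∊ x ⟺ (y ∊ a ⩓ cls φ y)

/-- The instance of Strong Collection for the class relation `φ`. -/
def strongCollection (φ : Fml) : Sc :=
  All fun a => (All fun x => x ∊ a ⟾ Ex fun y => rel φ x y) ⟾
    Ex fun b => (All fun x => x ∊ a ⟾ Ex fun y => y ∊ b ⩓ rel φ x y) ⩓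
      (All fun y => y ∊ b ⟾ Ex fun x => x ∊ a ⩓ rel φ x y)

/-- The instance of Set Induction for the class `φ`. -/
def setInduction (φ : Fml) : Sc :=
  (All fun a => (All fun x => x ∊ a ⟾ cls φ x) ⟾ cls φ a) ⟾ All fun a => cls φ a

/-- `CZF` without Subset Collection. -/
inductive CZFMinus : Set Fml
  | extensionality : CZFMinus (extensionality 0)
  | pairing : CZFMinus (pairing 0)
  | union : CZFMinus (union 0)
  | infinity : CZFMinus (infinity 0)
  | restrictedSeparation {φ : Fml} : φ.IsRestricted → CZFMinus (separation φ 0)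
  | strongCollection (φ : Fml) : CZFMinus (strongCollection φ 0)
  | setInduction (φ : Fml) : CZFMinus (setInduction φ 0)

/-- The full Separation scheme. -/
def FullSeparation : Set Fml := Set.range fun φ => separation φ 0

/-! ### Set-generated join-semilattices, as notions of the object language

Below `L` is a class, `le` and `G` are class relations, and `B` is a set. -/

/-- `(L, le)` is a partially ordered class. -/
def IsPoclass (L : Var → Sc) (le : Var → Var → Sc) : Sc :=
  (All fun x => L x ⟾ le x x) ⩓
  (All fun x => All fun y => All fun z => L x ⟾ L y ⟾ L z ⟾ le x y ⟾ le y z ⟾ le x z) ⩓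
  (All fun x => All fun y => L x ⟾ L y ⟾ le x y ⟾ le y x ⟾ x ≐ y)

/-- `s` is the supremum in `L` of the set `u`. -/
def IsSup (L : Var → Sc) (le : Var → Var → Sc) (u s : Var) : Sc :=
  L s ⩓ (All fun x => x ∊ u ⟾ le x s) ⩓
    (All fun y => L y ⟾ (All fun x => x ∊ u ⟾ le x y) ⟾ le s y)

/-- Every subset of `L` has a supremum. -/
def HasSups (L : Var → Sc) (le : Var → Var → Sc) : Sc :=
  All fun u => (All fun x => x ∊ u ⟾ L x) ⟾ Ex fun s => IsSup L le u s

/-- `B` is a generating set: a subset of `L` such that, for every `x` in `L`, the class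
`{b ∈ B | b ≤ x}` is a set whose supremum is `x`. -/
def IsGenerating (L : Var → Sc) (le : Var → Var → Sc) (B : Var) : Sc :=
  (All fun b => b ∊ B ⟾ L b) ⩓
  (All fun x => L x ⟾ Ex fun d => (All fun b => b ∊ d ⟺ (b ∊ B ⩓ le b x)) ⩓ IsSup L le d x)

/-- `(L, le)` is a join-semilattice with generating set `B`. -/
def IsSetGenerated (L : Var → Sc) (le : Var → Var → Sc) (B : Var) : Sc :=
  IsPoclass L le ⩓ HasSups L le ⩓ IsGenerating L le B

/-- `G` is (the graph of) a monotone class function from `L` to `L`. -/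
def IsMonotoneOperator (L : Var → Sc) (le G : Var → Var → Sc) : Sc :=
  (All fun x => L x ⟾ Ex fun y => L y ⩓ G x y ⩓ All fun z => L z ⟾ G x z ⟾ z ≐ y) ⩓
  (All fun x => All fun x' => All fun y => All fun y' =>
    L x ⟾ L x' ⟾ L y ⟾ L y' ⟾ G x y ⟾ G x' y' ⟾ le x x' ⟾ le y y')

/-- `p` is the least fixed point of `G`. -/
def IsLeastFixedPoint (L : Var → Sc) (le G : Var → Var → Sc) (p : Var) : Sc :=
  L p ⩓ G p p ⩓ All fun q => L q ⟾ G q q ⟾ le p q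

/-- The class `Y` is a subclass of `B` that contains `{b ∈ B | b ≤ ⋁ u}` for each subset `u`
of `Y`. -/
def IsJoinClosed (L : Var → Sc) (le : Var → Var → Sc) (B : Var) (Y : Var → Sc) : Sc :=
  (All fun y => Y y ⟾ y ∊ B) ⩓
  (All fun u => (All fun x => x ∊ u ⟾ Y x) ⟾
    All fun s => IsSup L le u s ⟾ All fun b => b ∊ B ⟾ le b s ⟾ Y b)

/-- `Y` is closed under the abstract inductive definition `Φ`, a class of pairs `(b, a)` with `b`
in `B` and `a` in `L`: it is join-closed, and `b ∈ Y` for every `(b, a)` in `Φ` such that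
`{d ∈ B | d ≤ a} ⊆ Y`. -/
def IsClosedUnder (L : Var → Sc) (le : Var → Var → Sc) (B : Var) (Φ : Var → Var → Sc)
    (Y : Var → Sc) : Sc :=
  IsJoinClosed L le B Y ⩓
  (All fun b => All fun a => Φ b a ⟾ (All fun d => d ∊ B ⟾ le d a ⟾ Y d) ⟾ Y b)

/-- The abstract inductive definition of the operator `G`: the pairs `(b, a)` in `B × L` such that
`b ≤ G(a)`. -/
def inductiveDef (L : Var → Sc) (le G : Var → Var → Sc) (B : Var) (b a : Var) : Sc :=
  b ∊ B ⩓ L a ⩓ Ex fun y => L y ⩓ G a y ⩓ le b y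

end CST

open CST

open CST

namespace CST

/-! ### Calculus of renamings -/

namespace Fml

/-! Call `y` in `L` prefixed if `G(y) ≤ y`. The least closed class is `I = {b ∈ B | b ≤ y for every
prefixed y}`: it quantifies over elements of `L` only, so it is given by a formula, and full
Separation on `B` makes it a set. `I` is closed because prefixed points bound joins and, by
monotonicity, `a ≤ y` with `y` prefixed gives `G(a) ≤ G(y) ≤ y` (`closed_leastClass`). If `Y` is
closed, Separation makes `Y` a set; its join `s` is prefixed and has its generators in `Y`, hence `I
⊆ Y` (`leastClass_minimal`). Finally `p = ⋁ I` is below every prefixed point, and Tarski's argument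
shows `G(p) = p` (`leastFixedPoint_sup`). Derivations are built inside the calculus: each formula
carries an environment `σ` for its parameters, and `simp` computes every substitution by acting on
`σ` and on the displayed variables. -/

theorem lift_comp (ρ τ : ℕ → ℕ) : lift ρ ∘ lift τ = lift (ρ ∘ τ) := by
  funext n; cases n <;> rfl

@[simp] theorem rename_rename (ρ τ : ℕ → ℕ) (φ : Fml) :
    (φ.rename τ).rename ρ = φ.rename (ρ ∘ τ) := by
  induction φ generalizing ρ τ <;> simp_all [rename, lift_comp]

/-- The environment `σ` seen below one more quantifier. -/
def up (σ : ℕ → ℕ) : ℕ → ℕ := fun k => σ k + 1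

/-- The environment sending `0` to `x` and `k + 1` to `σ k`. -/
def scons (x : ℕ) (σ : ℕ → ℕ) : ℕ → ℕ
  | 0 => x
  | k + 1 => σ k

/-- The class `{x | φ(x)}` with parameters read in the environment `σ`. -/
def cl (φ : Fml) (σ : ℕ → ℕ) (x : ℕ) : Fml := φ.rename (scons x σ)

/-- The class relation `{(x, y) | φ(x, y)}` with parameters read in the environment `σ`. -/
def rl (φ : Fml) (σ : ℕ → ℕ) (x y : ℕ) : Fml := φ.rename (scons x (scons y σ))

theorem comp_scons (ρ σ : ℕ → ℕ) (x : ℕ) : ρ ∘ scons x σ = scons (ρ x) (ρ ∘ σ) := by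
  funext n; cases n <;> rfl

@[simp] theorem rename_cl (φ : Fml) (ρ σ : ℕ → ℕ) (x : ℕ) :
    (φ.cl σ x).rename ρ = φ.cl (ρ ∘ σ) (ρ x) := by
  simp [cl, comp_scons]

@[simp] theorem rename_rl (φ : Fml) (ρ σ : ℕ → ℕ) (x y : ℕ) :
    (φ.rl σ x y).rename ρ = φ.rl (ρ ∘ σ) (ρ x) (ρ y) := by
  simp [rl, comp_scons]

@[simp] theorem inst_eq_rename (φ : Fml) (t : ℕ) : φ.inst t = φ.rename (scons t id) := by
  unfold inst; congr 1

@[simp] theorem shift_eq_rename (φ : Fml) : φ.shift = φ.rename Nat.succ := rfl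

@[simp] theorem lift_comp_up (ρ σ : ℕ → ℕ) : lift ρ ∘ up σ = up (ρ ∘ σ) := rfl
@[simp] theorem scons_comp_up (t : ℕ) (τ σ : ℕ → ℕ) : scons t τ ∘ up σ = τ ∘ σ := rfl
@[simp] theorem succ_comp (σ : ℕ → ℕ) : Nat.succ ∘ σ = up σ := rfl
@[simp] theorem lift_zero (ρ : ℕ → ℕ) : lift ρ 0 = 0 := rfl
@[simp] theorem lift_one (ρ : ℕ → ℕ) : lift ρ 1 = ρ 0 + 1 := rfl
@[simp] theorem lift_succ (ρ : ℕ → ℕ) (n : ℕ) : lift ρ (n + 1) = ρ n + 1 := rfl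
@[simp] theorem scons_zero (t : ℕ) (σ : ℕ → ℕ) : scons t σ 0 = t := rfl
@[simp] theorem scons_succ (t : ℕ) (σ : ℕ → ℕ) (n : ℕ) : scons t σ (n + 1) = σ n := rfl
@[simp] theorem up_apply (σ : ℕ → ℕ) (n : ℕ) : up σ n = σ n + 1 := rfl

attribute [simp] rename

end Fml

open Fml

/-! ### The notions of the theorem in de Bruijn form -/

variable (L le G : Fml) (B : ℕ)

/-- `x ≤ s` for every `x` in the set `u`. -/
def upperBoundF (σ : ℕ → ℕ) (u s : ℕ) : Fml := .all (.imp (.mem 0 (u + 1)) (le.rl (up σ) 0 (s + 1)))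

/-- `s` is the supremum of the set `u`. -/
def supF (σ : ℕ → ℕ) (u s : ℕ) : Fml :=
  .and (L.cl σ s) (.and (upperBoundF le σ u s)
    (.all (.imp (L.cl (up σ) 0) (.imp (upperBoundF le (up σ) (u + 1) 0) (le.rl (up σ) (s + 1) 0)))))

def iffF (φ ψ : Fml) : Fml := .and (.imp φ ψ) (.imp ψ φ)

/-- The set `u` is included in the class `Y`. -/
def subF (Y : Fml) (σ : ℕ → ℕ) (u : ℕ) : Fml := .all (.imp (.mem 0 (u + 1)) (Y.cl (up σ) 0))

def poclassF (σ : ℕ → ℕ) : Fml :=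
  .and (.all (.imp (L.cl (up σ) 0) (le.rl (up σ) 0 0))) (.and
    (.all (.all (.all (.imp (L.cl (up (up (up σ))) 2) (.imp (L.cl (up (up (up σ))) 1)
      (.imp (L.cl (up (up (up σ))) 0) (.imp (le.rl (up (up (up σ))) 2 1)
        (.imp (le.rl (up (up (up σ))) 1 0) (le.rl (up (up (up σ))) 2 0)))))))))
    (.all (.all (.imp (L.cl (up (up σ)) 1) (.imp (L.cl (up (up σ)) 0)
      (.imp (le.rl (up (up σ)) 1 0) (.imp (le.rl (up (up σ)) 0 1) (.eq 1 0))))))))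

def supsF (σ : ℕ → ℕ) : Fml := .all (.imp (subF L (up σ) 0) (.ex (supF L le (up (up σ)) 1 0)))

def generatingF (σ : ℕ → ℕ) : Fml :=
  .and (.all (.imp (.mem 0 (σ B + 1)) (L.cl (up σ) 0)))
    (.all (.imp (L.cl (up σ) 0) (.ex (.and
      (.all (iffF (.mem 0 1) (.and (.mem 0 (σ B + 3)) (le.rl (up (up (up σ))) 0 2))))
      (supF L le (up (up σ)) 0 1)))))

def monotoneF (σ : ℕ → ℕ) : Fml :=
  .and (.all (.imp (L.cl (up σ) 0) (.ex (.and (L.cl (up (up σ)) 0) (.and (G.rl (up (up σ)) 1 0)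
      (.all (.imp (L.cl (up (up (up σ))) 0) (.imp (G.rl (up (up (up σ))) 2 0) (.eq 0 1)))))))))
    (.all (.all (.all (.all (.imp (L.cl (up (up (up (up σ)))) 3)
      (.imp (L.cl (up (up (up (up σ)))) 2) (.imp (L.cl (up (up (up (up σ)))) 1)
      (.imp (L.cl (up (up (up (up σ)))) 0) (.imp (G.rl (up (up (up (up σ)))) 3 1)
      (.imp (G.rl (up (up (up (up σ)))) 2 0) (.imp (le.rl (up (up (up (up σ)))) 3 2)
        (le.rl (up (up (up (up σ)))) 1 0))))))))))))

/-- `G` is a monotone operator on the join-semilattice `(L, le)` with generating set `B`. -/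
def settingF (σ : ℕ → ℕ) : Fml :=
  .and (.and (poclassF L le σ) (.and (supsF L le σ) (generatingF L le B σ))) (monotoneF L le G σ)


theorem cls_eq (φ : Fml) (x : Var) (d : ℕ) : cls φ x d = φ.cl (fun k => k + d) (x d) := by
  unfold cls cl; congr 1

theorem rel_eq (φ : Fml) (x y : Var) (d : ℕ) :
    rel φ x y d = φ.rl (fun k => k + d) (x d) (y d) := by
  unfold rel rl; congr 1; funext n; rcases n with _ | _ | n <;> rfl

/-- At depth `d` a free variable `k` is read as `k + d`, which is what `d` applications of `up` to
`id` compute to; hence `rfl` after unfolding. -/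
theorem settingF_eq :
    (IsSetGenerated (cls L) (rel le) (free B) ⩓
      IsMonotoneOperator (cls L) (rel le) (rel G)) 0 = settingF L le G B id := by
  simp only [IsSetGenerated, IsPoclass, HasSups, IsGenerating, IsMonotoneOperator, IsSup, All, Ex,
    Conj, Impl, Equi, Mem, Eqv, cls_eq, rel_eq, free]
  rfl

/-- `y` is a prefixed point of `G`. -/
def prefixedF (σ : ℕ → ℕ) (y : ℕ) : Fml :=
  .all (.imp (L.cl (up σ) 0) (.imp (G.rl (up σ) (y + 1) 0) (le.rl (up σ) 0 (y + 1))))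

/-- `b` is an element of `B` below all prefixed points of `G`. -/
def leastF (σ : ℕ → ℕ) (b : ℕ) : Fml :=
  .and (.mem b (σ B)) (.all (.imp (L.cl (up σ) 0)
    (.imp (prefixedF L le G (up σ) 0) (le.rl (up σ) (b + 1) 0))))

/-- The elements of `i` are the elements of `B` in the class `Y`. -/
def comprehendsF (Y : Fml) (σ : ℕ → ℕ) (i : ℕ) : Fml :=
  .all (iffF (.mem 0 (i + 1)) (.and (.mem 0 (σ B + 1)) (Y.cl (up σ) 0)))

/-- Every element of `B` below `x` is below `y`. -/
def downLeF (σ : ℕ → ℕ) (x y : ℕ) : Fml :=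
  .all (.imp (.mem 0 (σ B + 1)) (.imp (le.rl (up σ) 0 (x + 1)) (le.rl (up σ) 0 (y + 1))))

/-- The elements of `d` are the elements of `B` below `x`. -/
def downsetF (σ : ℕ → ℕ) (d x : ℕ) : Fml :=
  .all (iffF (.mem 0 (d + 1)) (.and (.mem 0 (σ B + 1)) (le.rl (up σ) 0 (x + 1))))

/-- Every element of `B` below `s` is in the class `Y`. -/
def downSubF (Y : Fml) (σ : ℕ → ℕ) (s : ℕ) : Fml :=
  .all (.imp (.mem 0 (σ B + 1)) (.imp (le.rl (up σ) 0 (s + 1)) (Y.cl (up σ) 0)))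

/-- The pair `(b, a)` is in the abstract inductive definition of `G`. -/
def inductiveDefF (σ : ℕ → ℕ) (b a : ℕ) : Fml :=
  .and (.mem b (σ B)) (.and (L.cl σ a)
    (.ex (.and (L.cl (up σ) 0) (.and (G.rl (up σ) (a + 1) 0) (le.rl (up σ) (b + 1) 0)))))

/-- The class `Y` is closed under the abstract inductive definition of `G`. -/
def closedF (Y : Fml) (σ : ℕ → ℕ) : Fml :=
  .and (.and (.all (.imp (Y.cl (up σ) 0) (.mem 0 (σ B + 1))))
      (.all (.imp (subF Y (up σ) 0) (.all (.imp (supF L le (up (up σ)) 1 0)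
        (downSubF le B Y (up (up σ)) 0))))))
    (.all (.all (.imp (inductiveDefF L le G B (up (up σ)) 1 0)
      (.imp (downSubF le B Y (up (up σ)) 0) (Y.cl (up (up σ)) 1)))))

/-! ### Substitution acts on environments and displayed variables -/

section rename
variable (ρ σ : ℕ → ℕ)

@[simp] theorem rename_upperBoundF (u s : ℕ) :
    (upperBoundF le σ u s).rename ρ = upperBoundF le (ρ ∘ σ) (ρ u) (ρ s) := by
  simp [upperBoundF]

@[simp] theorem rename_supF (u s : ℕ) :
    (supF L le σ u s).rename ρ = supF L le (ρ ∘ σ) (ρ u) (ρ s) := by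
  simp [supF]

@[simp] theorem rename_iffF (φ ψ : Fml) :
    (iffF φ ψ).rename ρ = iffF (φ.rename ρ) (ψ.rename ρ) := rfl

@[simp] theorem rename_subF (Y : Fml) (u : ℕ) :
    (subF Y σ u).rename ρ = subF Y (ρ ∘ σ) (ρ u) := by
  simp [subF]

@[simp] theorem rename_settingF :
    (settingF L le G B σ).rename ρ = settingF L le G B (ρ ∘ σ) := by
  simp [settingF, poclassF, supsF, generatingF, monotoneF]

@[simp] theorem rename_prefixedF (y : ℕ) :
    (prefixedF L le G σ y).rename ρ = prefixedF L le G (ρ ∘ σ) (ρ y) := by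
  simp [prefixedF]

@[simp] theorem rename_leastF (b : ℕ) :
    (leastF L le G B σ b).rename ρ = leastF L le G B (ρ ∘ σ) (ρ b) := by
  simp [leastF]

@[simp] theorem rename_comprehendsF (Y : Fml) (i : ℕ) :
    (comprehendsF B Y σ i).rename ρ = comprehendsF B Y (ρ ∘ σ) (ρ i) := by
  simp [comprehendsF]

@[simp] theorem rename_downLeF (x y : ℕ) :
    (downLeF le B σ x y).rename ρ = downLeF le B (ρ ∘ σ) (ρ x) (ρ y) := by
  simp [downLeF]

@[simp] theorem rename_downsetF (d x : ℕ) :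
    (downsetF le B σ d x).rename ρ = downsetF le B (ρ ∘ σ) (ρ d) (ρ x) := by
  simp [downsetF]

@[simp] theorem rename_downSubF (Y : Fml) (s : ℕ) :
    (downSubF le B Y σ s).rename ρ = downSubF le B Y (ρ ∘ σ) (ρ s) := by
  simp [downSubF]

@[simp] theorem rename_inductiveDefF (b a : ℕ) :
    (inductiveDefF L le G B σ b a).rename ρ = inductiveDefF L le G B (ρ ∘ σ) (ρ b) (ρ a) := by
  simp [inductiveDefF]

@[simp] theorem rename_closedF (Y : Fml) :
    (closedF L le G B Y σ).rename ρ = closedF L le G B Y (ρ ∘ σ) := by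
  simp [closedF]

end rename

/-- The class of elements of `B` below all prefixed points of `G`. -/
def leastClass : Fml := leastF L le G B (up id) 0

@[simp] theorem cl_leastClass (σ : ℕ → ℕ) (b : ℕ) :
    (leastClass L le G B).cl σ b = leastF L le G B σ b := by
  simp [leastClass, cl]

variable {L le G B} {T : Set Fml} {Γ : List Fml} {σ : ℕ → ℕ} {φ ψ Y : Fml}
  {b d i p q s u x y z x' y' : ℕ}

/-! ### Derived rules -/

namespace Prf

theorem cut (h : Prf T Γ φ) (k : Prf T (φ :: Γ) ψ) : Prf T Γ ψ := impE (impI k) h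

/-- Keeping the instance `ψ` apart from `φ.inst t` lets the substitution be evaluated by `simp` or
by `rfl`. -/
theorem allE_eq (t : ℕ) (h : Prf T Γ (.all φ)) (e : φ.rename (scons t id) = ψ := by simp) :
    Prf T Γ ψ := by
  rw [← e, ← inst_eq_rename]; exact allE t h

theorem exI_eq (t : ℕ) (h : Prf T Γ ψ) (e : φ.rename (scons t id) = ψ := by simp) :
    Prf T Γ (.ex φ) := by
  rw [← e, ← inst_eq_rename] at h; exact exI t h

theorem upperBound_le (h : Prf T Γ (upperBoundF le σ u s)) (hx : Prf T Γ (.mem x u)) :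
    Prf T Γ (le.rl σ x s) :=
  (h.allE_eq x (ψ := .imp (.mem x u) (le.rl σ x s))).impE hx

theorem of_subF (h : Prf T Γ (subF Y σ u)) (hx : Prf T Γ (.mem x u)) : Prf T Γ (Y.cl σ x) :=
  (h.allE_eq x (ψ := .imp (.mem x u) (Y.cl σ x))).impE hx

theorem sup_mem (h : Prf T Γ (supF L le σ u s)) : Prf T Γ (L.cl σ s) := h.andE₁

theorem le_sup (h : Prf T Γ (supF L le σ u s)) (hx : Prf T Γ (.mem x u)) :
    Prf T Γ (le.rl σ x s) := h.andE₂.andE₁.upperBound_le hx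

theorem sup_le (h : Prf T Γ (supF L le σ u s)) (hy : Prf T Γ (L.cl σ y))
    (hu : Prf T Γ (upperBoundF le σ u y)) : Prf T Γ (le.rl σ s y) :=
  ((h.andE₂.andE₂.allE_eq y
    (ψ := .imp (L.cl σ y) (.imp (upperBoundF le σ u y) (le.rl σ s y)))).impE hy).impE hu

theorem prefixed_le (h : Prf T Γ (prefixedF L le G σ y)) (hz : Prf T Γ (L.cl σ z))
    (g : Prf T Γ (G.rl σ y z)) : Prf T Γ (le.rl σ z y) :=
  ((h.allE_eq z (ψ := .imp (L.cl σ z) (.imp (G.rl σ y z) (le.rl σ z y)))).impE hz).impE g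

theorem least_mem (h : Prf T Γ (leastF L le G B σ b)) : Prf T Γ (.mem b (σ B)) := h.andE₁

theorem least_le (h : Prf T Γ (leastF L le G B σ b)) (hy : Prf T Γ (L.cl σ y))
    (k : Prf T Γ (prefixedF L le G σ y)) : Prf T Γ (le.rl σ b y) :=
  ((h.andE₂.allE_eq y
    (ψ := .imp (L.cl σ y) (.imp (prefixedF L le G σ y) (le.rl σ b y)))).impE hy).impE k

theorem comprehends_mem (h : Prf T Γ (comprehendsF B Y σ i)) (hb : Prf T Γ (.mem b (σ B)))
    (hY : Prf T Γ (Y.cl σ b)) : Prf T Γ (.mem b i) :=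
  (h.allE_eq b (ψ := iffF (.mem b i) (.and (.mem b (σ B)) (Y.cl σ b)))).andE₂.impE (hb.andI hY)

theorem of_comprehends (h : Prf T Γ (comprehendsF B Y σ i)) (hb : Prf T Γ (.mem b i)) :
    Prf T Γ (.and (.mem b (σ B)) (Y.cl σ b)) :=
  (h.allE_eq b (ψ := iffF (.mem b i) (.and (.mem b (σ B)) (Y.cl σ b)))).andE₁.impE hb

theorem of_downset (h : Prf T Γ (downsetF le B σ d x)) (hb : Prf T Γ (.mem b d)) :
    Prf T Γ (.and (.mem b (σ B)) (le.rl σ b x)) :=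
  (h.allE_eq b (ψ := iffF (.mem b d) (.and (.mem b (σ B)) (le.rl σ b x)))).andE₁.impE hb

theorem of_downLe (h : Prf T Γ (downLeF le B σ x y)) (hb : Prf T Γ (.mem b (σ B)))
    (hx : Prf T Γ (le.rl σ b x)) : Prf T Γ (le.rl σ b y) :=
  ((h.allE_eq b
    (ψ := .imp (.mem b (σ B)) (.imp (le.rl σ b x) (le.rl σ b y)))).impE hb).impE hx

theorem of_downSub (h : Prf T Γ (downSubF le B Y σ s)) (hb : Prf T Γ (.mem b (σ B)))
    (hs : Prf T Γ (le.rl σ b s)) : Prf T Γ (Y.cl σ b) :=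
  ((h.allE_eq b (ψ := .imp (.mem b (σ B)) (.imp (le.rl σ b s) (Y.cl σ b)))).impE hb).impE hs

theorem closed_sup (h : Prf T Γ (closedF L le G B Y σ)) (hu : Prf T Γ (subF Y σ u))
    (hs : Prf T Γ (supF L le σ u s)) : Prf T Γ (downSubF le B Y σ s) :=
  impE (allE_eq s (impE (allE_eq u h.andE₁.andE₂ (ψ := .imp (subF Y σ u)
    (.all (.imp (supF L le (up σ) (u + 1) 0) (downSubF le B Y (up σ) 0))))) hu)
    (ψ := .imp (supF L le σ u s) (downSubF le B Y σ s))) hs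

theorem closed_ind (h : Prf T Γ (closedF L le G B Y σ))
    (hb : Prf T Γ (inductiveDefF L le G B σ b s)) (hs : Prf T Γ (downSubF le B Y σ s)) :
    Prf T Γ (Y.cl σ b) :=
  impE (impE (allE_eq s (allE_eq b h.andE₂ rfl)
    (ψ := .imp (inductiveDefF L le G B σ b s) (.imp (downSubF le B Y σ s) (Y.cl σ b)))) hb) hs

section setting
variable (h : Prf T Γ (settingF L le G B σ))
include h

theorem le_refl (hx : Prf T Γ (L.cl σ x)) : Prf T Γ (le.rl σ x x) :=
  (h.andE₁.andE₁.andE₁.allE_eq x (ψ := .imp (L.cl σ x) (le.rl σ x x))).impE hx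

theorem le_trans (hx : Prf T Γ (L.cl σ x)) (hy : Prf T Γ (L.cl σ y)) (hz : Prf T Γ (L.cl σ z))
    (hxy : Prf T Γ (le.rl σ x y)) (hyz : Prf T Γ (le.rl σ y z)) : Prf T Γ (le.rl σ x z) :=
  impE (impE (impE (impE (impE
    (allE_eq z (allE_eq y (allE_eq x h.andE₁.andE₁.andE₂.andE₁ rfl) rfl)) hx) hy) hz) hxy) hyz

theorem le_antisymm (hx : Prf T Γ (L.cl σ x)) (hy : Prf T Γ (L.cl σ y))
    (hxy : Prf T Γ (le.rl σ x y)) (hyx : Prf T Γ (le.rl σ y x)) : Prf T Γ (.eq x y) :=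
  impE (impE (impE (impE
    (allE_eq y (allE_eq x h.andE₁.andE₁.andE₂.andE₂ rfl)) hx) hy) hxy) hyx

theorem exists_sup (hu : Prf T Γ (subF L σ u)) : Prf T Γ (.ex (supF L le (up σ) (u + 1) 0)) :=
  (h.andE₁.andE₂.andE₁.allE_eq u
    (ψ := .imp (subF L σ u) (.ex (supF L le (up σ) (u + 1) 0)))).impE hu

theorem generator_mem (hb : Prf T Γ (.mem b (σ B))) : Prf T Γ (L.cl σ b) :=
  (h.andE₁.andE₂.andE₂.andE₁.allE_eq b (ψ := .imp (.mem b (σ B)) (L.cl σ b))).impE hb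

theorem exists_down (hx : Prf T Γ (L.cl σ x)) :
    Prf T Γ (.ex (.and (downsetF le B (up σ) 0 (x + 1)) (supF L le (up σ) 0 (x + 1)))) :=
  impE (allE_eq x h.andE₁.andE₂.andE₂.andE₂ (by simp [downsetF])) hx

theorem exists_value (hx : Prf T Γ (L.cl σ x)) :
    Prf T Γ (.ex (.and (L.cl (up σ) 0) (.and (G.rl (up σ) (x + 1) 0)
      (.all (.imp (L.cl (up (up σ)) 0) (.imp (G.rl (up (up σ)) (x + 2) 0) (.eq 0 1))))))) :=
  impE (allE_eq x h.andE₂.andE₁) hx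

theorem monotone (hx : Prf T Γ (L.cl σ x)) (hx' : Prf T Γ (L.cl σ x')) (hy : Prf T Γ (L.cl σ y))
    (hy' : Prf T Γ (L.cl σ y')) (g : Prf T Γ (G.rl σ x y)) (g' : Prf T Γ (G.rl σ x' y'))
    (hxx' : Prf T Γ (le.rl σ x x')) : Prf T Γ (le.rl σ y y') :=
  impE (impE (impE (impE (impE (impE (impE
    (allE_eq y' (allE_eq y (allE_eq x' (allE_eq x h.andE₂.andE₂ rfl) rfl) rfl))
    hx) hx') hy) hy') g) g') hxx'

end setting

/-- Once `simp` has unfolded membership in a concrete context, the argument `F` becomes a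
conjunction of derivations, one per open assumption, with shifts already computed. -/
theorem of_hyps (h : (∀ ψ ∈ Γ, Prf T Γ ψ) → Prf T Γ φ) : Prf T Γ φ := h fun _ => hyp

theorem of_comprehends_leastClass (h : Prf T Γ (comprehendsF B (leastClass L le G B) σ i))
    (hb : Prf T Γ (.mem b i)) : Prf T Γ (leastF L le G B σ b) := by
  simpa using (h.of_comprehends hb).andE₂

theorem inductiveDef_intro (hb : Prf T Γ (.mem b (σ B))) (hx : Prf T Γ (L.cl σ x))
    (hy : Prf T Γ (L.cl σ y)) (g : Prf T Γ (G.rl σ x y)) (hby : Prf T Γ (le.rl σ b y)) :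
    Prf T Γ (inductiveDefF L le G B σ b x) :=
  hb.andI (hx.andI (exI_eq y (hy.andI (g.andI hby))))

/-! ### Generators and prefixed points -/

/-- The generators determine the order. -/
theorem le_of_downLe (h : Prf T Γ (settingF L le G B σ)) (hx : Prf T Γ (L.cl σ x))
    (hy : Prf T Γ (L.cl σ y)) (hd : Prf T Γ (downLeF le B σ x y)) : Prf T Γ (le.rl σ x y) := by
  -- Derivations in `Γ` do not carry over to the shifted context under a quantifier. Discharging
  -- them as implications puts their conclusions into the context, where they are shifted along.
  suffices Prf T Γ (.imp (downLeF le B σ x y) (.imp (L.cl σ y) (le.rl σ x y))) from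
    (this.impE hd).impE hy
  refine (exists_down h hx).exE (impI (impI (of_hyps fun F => ?_)))
  simp at F ⊢
  obtain ⟨Fy, Fd, Fx, -⟩ := F
  -- Since `x` is the join of its generators, it is enough that `y` bounds them.
  refine Fx.andE₂.sup_le Fy (.allI (impI (of_hyps fun F => ?_)))
  simp at F ⊢
  obtain ⟨F0, Fy, Fd, Fx, -⟩ := F
  have := Fx.andE₁.of_downset F0
  exact Fd.of_downLe this.andE₁ this.andE₂

/-- A point `x` with `G(x) ≤ x` is prefixed. -/
theorem prefixed_of_value_le (h : Prf T Γ (settingF L le G B σ)) (hx : Prf T Γ (L.cl σ x))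
    (hy : Prf T Γ (L.cl σ y)) (g : Prf T Γ (G.rl σ x y)) (hyx : Prf T Γ (le.rl σ y x)) :
    Prf T Γ (prefixedF L le G σ x) := by
  suffices Prf T Γ (.imp (settingF L le G B σ) (.imp (L.cl σ x) (.imp (L.cl σ y)
      (.imp (G.rl σ x y) (.imp (le.rl σ y x) (prefixedF L le G σ x)))))) from
    ((((this.impE h).impE hx).impE hy).impE g).impE hyx
  refine impI (impI (impI (impI (impI (allI (impI (impI (of_hyps fun F => ?_))))))))
  simp at F ⊢
  obtain ⟨Fg, Fz, Fyx, Fxy, Fy, Fx, F, -⟩ := F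
  -- Monotonicity at `x ≤ x` puts any value `z` of `G` at `x` below the given value `y`.
  exact F.le_trans Fz Fy Fx (F.monotone Fx Fx Fz Fy Fg Fxy (F.le_refl Fx)) Fyx

/-- The value at a prefixed point is prefixed. -/
theorem prefixed_value (h : Prf T Γ (settingF L le G B σ)) (hx : Prf T Γ (L.cl σ x))
    (hy : Prf T Γ (L.cl σ y)) (g : Prf T Γ (G.rl σ x y)) (hyx : Prf T Γ (le.rl σ y x)) :
    Prf T Γ (prefixedF L le G σ y) := by
  suffices Prf T Γ (.imp (settingF L le G B σ) (.imp (L.cl σ x) (.imp (L.cl σ y)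
      (.imp (G.rl σ x y) (.imp (le.rl σ y x) (prefixedF L le G σ y)))))) from
    ((((this.impE h).impE hx).impE hy).impE g).impE hyx
  refine impI (impI (impI (impI (impI (allI (impI (impI (of_hyps fun F => ?_))))))))
  simp at F ⊢
  obtain ⟨Fg, Fz, Fyx, Fxy, Fy, Fx, F, -⟩ := F
  exact F.monotone Fy Fx Fz Fy Fg Fxy Fyx

/-- If `x ≤ y` and `y` is prefixed, then every generator below `G(x)` is below `y`. -/
theorem le_prefixed (h : Prf T Γ (settingF L le G B σ)) (hb : Prf T Γ (.mem b (σ B)))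
    (hx : Prf T Γ (L.cl σ x)) (hz : Prf T Γ (L.cl σ z)) (hy : Prf T Γ (L.cl σ y))
    (g : Prf T Γ (G.rl σ x z)) (hbz : Prf T Γ (le.rl σ b z)) (hxy : Prf T Γ (le.rl σ x y))
    (hp : Prf T Γ (prefixedF L le G σ y)) : Prf T Γ (le.rl σ b y) := by
  suffices Prf T Γ (.imp (settingF L le G B σ) (.imp (.mem b (σ B)) (.imp (L.cl σ x)
      (.imp (L.cl σ z) (.imp (L.cl σ y) (.imp (G.rl σ x z) (.imp (le.rl σ b z)
      (.imp (le.rl σ x y) (.imp (prefixedF L le G σ y) (le.rl σ b y)))))))))) from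
    ((((((((this.impE h).impE hb).impE hx).impE hz).impE hy).impE g).impE hbz).impE hxy).impE hp
  refine (exists_value h hy).exE ?_
  refine impI (impI (impI (impI (impI (impI (impI (impI (impI (of_hyps fun F => ?_)))))))))
  simp at F ⊢
  obtain ⟨Fp, Fxy, Fbz, Fg, Fy, Fz, Fx, Fb, F, Fv, -⟩ := F
  have Fb := F.generator_mem Fb
  -- The chain is `b ≤ G(x) ≤ G(y) ≤ y`.
  exact F.le_trans Fb Fz Fy Fbz (F.le_trans Fz Fv.andE₁ Fy
    (F.monotone Fx Fy Fz Fv.andE₁ Fg Fv.andE₂.andE₁ Fxy) (Fp.prefixed_le Fv.andE₁ Fv.andE₂.andE₁))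

/-! ### Separation on `B` and the least closed class -/

/-- Comprehension of the class `Y` on the set `B`. -/
theorem exists_comprehends (hT : FullSeparation ⊆ T) (B : ℕ) (Y : Fml) (σ : ℕ → ℕ) :
    Prf T Γ (.ex (comprehendsF B Y (up σ) 0)) := by
  -- Axiom instances read their parameters in the identity environment, so `σ` is built into the
  -- formula; `lift` keeps the element variable `0` fixed.
  refine allE_eq (σ B) (ax (hT ⟨Y.rename (lift σ), rfl⟩)) ?_
  have (τ : ℕ → ℕ) (x : ℕ) : scons x τ ∘ lift σ = scons x (τ ∘ σ) := by
    funext n; cases n <;> rfl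
  simp only [Ex, All, Equi, Conj, Impl, Mem, cls_eq]
  simp [cl, this, comprehendsF, iffF, comp_scons]
  rfl

/-- A set `i` comprehending a class on `B` has a supremum. -/
theorem exists_sup_of_comprehends (h : Prf T Γ (settingF L le G B σ))
    (hi : Prf T Γ (comprehendsF B Y σ i)) : Prf T Γ (.ex (supF L le (up σ) (i + 1) 0)) := by
  refine h.exists_sup ?_
  suffices Prf T Γ (.imp (settingF L le G B σ) (.imp (comprehendsF B Y σ i) (subF L σ i))) from
    (this.impE h).impE hi
  refine impI (impI (allI (impI (of_hyps fun F => ?_))))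
  simp at F ⊢
  obtain ⟨F0, Fi, F, -⟩ := F
  exact F.generator_mem (Fi.of_comprehends F0).andE₁

theorem closed_leastClass : Prf T Γ (.imp (settingF L le G B σ)
    (closedF L le G B (leastClass L le G B) σ)) := by
  refine impI (andI (andI ?_ ?_) ?_)
  · refine allI (impI (of_hyps fun F => ?_))
    simp at F ⊢
    exact F.1.least_mem
  · refine allI (impI (allI (impI (allI (impI (impI ?_))))))
    simp
    refine andI (hyp (by simp)) (allI (impI (impI (of_hyps fun F => ?_))))
    simp at F ⊢
    obtain ⟨Fp, Fy, Fbs, Fb, Fs, Fu, F, -⟩ := F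
    -- A prefixed `y` bounds a subset of the least class, hence also its join and every generator
    -- below that join.
    refine F.le_trans (F.generator_mem Fb) Fs.sup_mem Fy Fbs (Fs.sup_le Fy ?_)
    refine allI (impI (of_hyps fun F => ?_))
    simp at F ⊢
    obtain ⟨F0, Fp, Fy, Fbs, Fb, Fs, Fu, F, -⟩ := F
    have := Fu.of_subF F0
    simp at this
    exact this.least_le Fy Fp
  · refine allI (allI (impI (impI ?_)))
    simp
    refine andI (of_hyps fun F => ?_) (allI (impI (impI (of_hyps fun F => ?_))))
    · simp at F
      exact F.2.1.andE₁
    simp at F ⊢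
    obtain ⟨Fp, Fy, Fd, Fi, F, -⟩ := F
    refine Fi.andE₂.andE₂.exE (of_hyps fun F => ?_)
    simp at F ⊢
    obtain ⟨Fv, Fp, Fy, Fd, Fi, F, -⟩ := F
    -- All generators below `a` lie below the prefixed `y`, so `a ≤ y`, and `b ≤ G(a)` gives `b ≤
    -- y`.
    refine F.le_prefixed Fi.andE₁ Fi.andE₂.andE₁ Fv.andE₁ Fy Fv.andE₂.andE₁ Fv.andE₂.andE₂
      (F.le_of_downLe Fi.andE₂.andE₁ Fy ?_) Fp
    refine allI (impI (impI (of_hyps fun F => ?_)))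
    simp at F ⊢
    obtain ⟨Fba, Fb, Fv, Fp, Fy, Fd, Fi, F, -⟩ := F
    have := Fd.of_downSub Fb Fba
    simp at this
    exact this.least_le Fy Fp

/-- Let `s` be the join of the set `w` of elements of `Y`. Join-closure puts every generator below
`s` in `Y`; the inductive clause then puts every generator below `G(s)` in `Y`, hence below `s`. So
`s` is prefixed, and elements of the least class are below `s`, hence in `Y`. -/
theorem leastClass_minimal (hT : FullSeparation ⊆ T) (Y : Fml) :
    Prf T Γ (.imp (settingF L le G B σ) (.imp (closedF L le G B Y σ)
      (.all (.imp ((leastClass L le G B).cl (up σ) 0) (Y.cl (up σ) 0))))) := by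
  refine impI (impI (exE (exists_comprehends hT B Y σ) (of_hyps fun F => ?_)))
  simp at F ⊢
  obtain ⟨Fw, FY, F, -⟩ := F
  refine exE (F.exists_sup_of_comprehends Fw) (of_hyps fun F => ?_)
  simp at F ⊢
  obtain ⟨Fs, Fw, FY, F, -⟩ := F
  -- Three eliminated existentials are in scope: `G(s)` is variable `0`, `s` is `1` and `w` is `2`.
  refine exE (F.exists_value Fs.sup_mem) (cut (φ := downSubF le B Y (up (up (up σ))) 1)
    (of_hyps fun F => ?_) (of_hyps fun F => ?_))
  · simp at F ⊢
    obtain ⟨Fv, Fs, Fw, FY, F, -⟩ := F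
    refine FY.closed_sup ?_ Fs
    refine allI (impI (of_hyps fun F => ?_))
    simp at F ⊢
    obtain ⟨F0, Fv, Fs, Fw, FY, F, -⟩ := F
    exact (Fw.of_comprehends F0).andE₂
  simp at F ⊢
  obtain ⟨Fd, Fv, Fs, Fw, FY, F, -⟩ := F
  refine cut (F.prefixed_of_value_le Fs.sup_mem Fv.andE₁ Fv.andE₂.andE₁
    (F.le_of_downLe Fv.andE₁ Fs.sup_mem ?_)) (allI (impI (of_hyps fun F => ?_)))
  · refine allI (impI (impI (of_hyps fun F => ?_)))
    simp at F ⊢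
    obtain ⟨Fbv, Fb, Fd, Fv, Fs, Fw, FY, F, -⟩ := F
    exact Fs.le_sup (Fw.comprehends_mem Fb (FY.closed_ind
      (inductiveDef_intro Fb Fs.sup_mem Fv.andE₁ Fv.andE₂.andE₁ Fbv) Fd))
  · simp at F ⊢
    obtain ⟨Fb, Fp, Fd, Fv, Fs, Fw, FY, F, -⟩ := F
    exact Fd.of_downSub Fb.least_mem (Fb.least_le Fs.sup_mem Fp)

end Prf

/-! ### The join of the least class is the least fixed point -/

/-- `p` is the least fixed point of `G`. -/
def leastFixedPointF (L le G : Fml) (σ : ℕ → ℕ) (p : ℕ) : Fml :=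
  .and (L.cl σ p) (.and (G.rl σ p p)
    (.all (.imp (L.cl (up σ) 0) (.imp (G.rl (up σ) 0 0) (le.rl (up σ) (p + 1) 0)))))

@[simp] theorem rename_leastFixedPointF (L le G : Fml) (ρ σ : ℕ → ℕ) (p : ℕ) :
    (leastFixedPointF L le G σ p).rename ρ = leastFixedPointF L le G (ρ ∘ σ) (ρ p) := by
  simp [leastFixedPointF]

namespace Prf

theorem sup_least_le (hi : Prf T Γ (comprehendsF B (leastClass L le G B) σ i))
    (hp : Prf T Γ (supF L le σ i p)) (hq : Prf T Γ (L.cl σ q))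
    (k : Prf T Γ (prefixedF L le G σ q)) : Prf T Γ (le.rl σ p q) := by
  refine hp.sup_le hq ?_
  suffices Prf T Γ (.imp (comprehendsF B (leastClass L le G B) σ i) (.imp (L.cl σ q)
      (.imp (prefixedF L le G σ q) (upperBoundF le σ i q)))) from ((this.impE hi).impE hq).impE k
  refine impI (impI (impI (allI (impI (of_hyps fun F => ?_)))))
  simp at F ⊢
  obtain ⟨F0, Fk, Fq, Fi, -⟩ := F
  exact (Fi.of_comprehends_leastClass F0).least_le Fq Fk

/-- A generator below `G(p)` is below every prefixed `q`, because `p ≤ q`; so it lies in `i`, and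
`G(p) ≤ p`. Then `G(p)` is itself prefixed, which gives `p ≤ G(p)`. -/
theorem leastFixedPoint_sup (h : Prf T Γ (settingF L le G B σ))
    (hi : Prf T Γ (comprehendsF B (leastClass L le G B) σ i)) (hp : Prf T Γ (supF L le σ i p)) :
    Prf T Γ (leastFixedPointF L le G σ p) := by
  suffices Prf T Γ (.imp (settingF L le G B σ) (.imp (comprehendsF B (leastClass L le G B) σ i)
      (.imp (supF L le σ i p) (leastFixedPointF L le G σ p)))) from
    ((this.impE h).impE hi).impE hp
  refine (h.exists_value hp.sup_mem).exE ?_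
  refine impI (impI (impI (cut (φ := le.rl (up σ) 0 (p + 1)) (of_hyps fun F => ?_)
    (of_hyps fun F => ?_))))
  · simp at F ⊢
    obtain ⟨Fp, Fi, F, Fv, -⟩ := F
    refine F.le_of_downLe Fv.andE₁ Fp.sup_mem (allI (impI (impI (of_hyps fun F => ?_))))
    simp at F ⊢
    obtain ⟨Fbv, Fb, Fp, Fi, F, Fv, -⟩ := F
    refine Fp.le_sup (Fi.comprehends_mem Fb ?_)
    rw [cl_leastClass]
    refine andI Fb (allI (impI (impI (of_hyps fun F => ?_))))
    simp at F ⊢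
    obtain ⟨Fk, Fq, Fbv, Fb, Fp, Fi, F, Fv, -⟩ := F
    exact F.le_prefixed Fb Fp.sup_mem Fv.andE₁ Fq Fv.andE₂.andE₁ Fbv (Fi.sup_least_le Fp Fq Fk) Fk
  · simp at F ⊢
    obtain ⟨Fvp, Fp, Fi, F, Fv, -⟩ := F
    have e := F.le_antisymm Fv.andE₁ Fp.sup_mem Fvp (Fi.sup_least_le Fp Fv.andE₁
      (F.prefixed_value Fp.sup_mem Fv.andE₁ Fv.andE₂.andE₁ Fvp))
    refine andI Fp.sup_mem (andI ?_ (allI (impI (impI (of_hyps fun F => ?_)))))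
    -- Variable `0` is the hole to be rewritten from `G(p)` to `p`; it accounts for the extra `up`
    -- and for `p + 2` instead of `p + 1`.
    · have := e.eqSubst (φ := G.rl (up (up σ)) (p + 2) 0) (by simpa using Fv.andE₂.andE₁)
      simpa using this
    · simp at F ⊢
      obtain ⟨Fg, Fq, Fvp, Fp, Fi, F, Fv, -⟩ := F
      -- Any fixed point is prefixed, being its own value.
      exact Fi.sup_least_le Fp Fq (F.prefixed_of_value_le Fq Fq Fg (F.le_refl Fq))

theorem exists_leastFixedPoint (hT : FullSeparation ⊆ T) :
    Prf T Γ (.imp (settingF L le G B σ) (.ex (.and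
      (.all (iffF (.mem 0 1) ((leastClass L le G B).cl (up (up σ)) 0)))
      (.ex (.and (supF L le (up (up σ)) 1 0) (leastFixedPointF L le G (up (up σ)) 0)))))) := by
  refine impI (exE (exists_comprehends hT B (leastClass L le G B) σ) (exI 0 ?_))
  simp
  refine andI (allI (andI (impI (of_hyps fun F => ?_)) (impI (of_hyps fun F => ?_))))
    (of_hyps fun F => ?_)
  · simp at F ⊢
    exact F.2.1.of_comprehends_leastClass F.1
  · simp at F ⊢
    exact F.2.1.comprehends_mem F.1.least_mem (by simpa using F.1)
  · simp at F
    obtain ⟨Fi, F, -⟩ := F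
    refine exE (F.exists_sup_of_comprehends Fi) (exI 0 (of_hyps fun F => ?_))
    simp at F ⊢
    obtain ⟨Fp, Fi, F, -⟩ := F
    exact Fp.andI (F.leastFixedPoint_sup Fi Fp)

end Prf

end CST

/-! ### Return to named bound variables -/

theorem mainTheorem2 (L le G : Fml) (B : ℕ) :
    ∃ I : Fml,
      -- `I` is closed under the inductive definition of `G` …
      Proves (CZFMinus ∪ FullSeparation)
        ((IsSetGenerated (cls L) (rel le) (free B) ⩓
            IsMonotoneOperator (cls L) (rel le) (rel G)) ⟾
          IsClosedUnder (cls L) (rel le) (free B)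
            (inductiveDef (cls L) (rel le) (rel G) (free B)) (cls I)) ∧
      -- … it is the least class with this property …
      (∀ Y : Fml, Proves (CZFMinus ∪ FullSeparation)
        ((IsSetGenerated (cls L) (rel le) (free B) ⩓
            IsMonotoneOperator (cls L) (rel le) (rel G)) ⟾
          IsClosedUnder (cls L) (rel le) (free B)
            (inductiveDef (cls L) (rel le) (rel G) (free B)) (cls Y) ⟾
          All fun b => cls I b ⟾ cls Y b)) ∧
      -- … it is a set, and its join is the least fixed point of `G`.
      Proves (CZFMinus ∪ FullSeparation)
        ((IsSetGenerated (cls L) (rel le) (free B) ⩓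
            IsMonotoneOperator (cls L) (rel le) (rel G)) ⟾
          Ex fun i => (All fun b => b ∊ i ⟺ cls I b) ⩓
            Ex fun p => IsSup (cls L) (rel le) i p ⩓
              IsLeastFixedPoint (cls L) (rel le) (rel G) p) := by
  have hT : FullSeparation ⊆ CZFMinus ∪ FullSeparation := Set.subset_union_right
  have closed_eq (Y : Fml) : IsClosedUnder (cls L) (rel le) (free B)
      (inductiveDef (cls L) (rel le) (rel G) (free B)) (cls Y) 0 = closedF L le G B Y id := by
    simp only [IsClosedUnder, IsJoinClosed, inductiveDef, IsSup, All, Ex, Conj, Impl, Mem, cls_eq,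
      rel_eq, free]
    rfl
  refine ⟨leastClass L le G B, ?_, fun Y => ?_, ?_⟩
  · simp only [Proves, Impl, settingF_eq, closed_eq]
    exact Prf.closed_leastClass
  · simp only [Proves, Impl, All, settingF_eq, closed_eq, cls_eq]
    exact Prf.leastClass_minimal hT Y
  · simp only [Proves, Impl, settingF_eq]
    simp only [IsSup, IsLeastFixedPoint, Equi, All, Ex, Conj, Impl, Mem, cls_eq, rel_eq]
    exact Prf.exists_leastFixedPoint hT
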